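/- Let $G=(V,E)$ be a finite simple graph and $r\ge 1$. In the PIR system of the $r$-multigraph $G^{(r)}$ the vertices are servers, and every edge $e\in E$ carries $r$ files $W_{e,1},\dots,W_{e,r}$, each stored exactly on the two endpoints of $e$; $\mathcal W_{S_i}$ denotes the set of files stored on server $i$. A PIR scheme with file length $L\ge 1$ consists of discrete random variables: independent files, each uniform on $\mathbb F_2^L$, and, for every desired file index $\theta$, queries $Q_i^{(\theta)}$ and answers $A_i^{(\theta)}$ ($i\in V$), such that for every $\theta$ and $i$ * the family of queries $(Q_i^{(\theta)})_{i\in V}$ is independent of the family of all files; * $H(A_i^{(\theta)}\mid Q_i^{(\theta)},\mathcal W_{S_i})=0$; * (reliability) $H(W_\theta\mid (A_j^{(\theta)})_{j\in V},(Q_j^{(\theta)})_{j\in V})=0$; * (privacy) the joint law of $(Q_i^{(\theta)},A_i^{(\theta)},\mathcal W_{S_i})$ does not depend on $\theta$. Here $H$ is Shannon entropy in bits. The rate of the scheme is $L/\sum_{i\in V}H(A_i)$ (by privacy $H(A_i)=H(A_i^{(\theta)})$ does not depend on $\theta$), and the PIR capacity $\mathscr C(G^{(r)})$ is the supremum of the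 rates of all schemes over all file lengths $L\ge1$. For $r=1$ we identify $G^{(1)}$ with $G$. A scheme on $G$ satisfies the symmetric retrieval property if for every $\theta$ and both servers $i$ that store $W_\theta$, $$H(A_i^{(\theta)}\mid Q_i^{(\theta)},\mathcal W_{S_i}\setminus\{W_\theta\})=\tfrac{L}{2}.$$ **Statement.** Let $\mathbb P_N$ be the path on $N$ vertices, where $N\ge 2$ is even. Then for every $r\ge1$ $$\mathscr C\bigl(\mathbb P_N^{(r)}\bigr)=\frac2N\cdot\frac1{2-2^{1-r}}.$$ Moreover, there is a PIR scheme on $\mathbb P_N$ with file length $L=2$ and rate exactly $2/N$ that satisfies the symmetric retrieval property. -/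

import Mathlib

open MeasureTheory ProbabilityTheory
open scoped ENNReal

noncomputable section

namespace MultigraphPIR

/-- Shannon entropy, in bits, of a discrete random variable `X`:
`H(X) = ∑ₛ -P(X = s) log₂ P(X = s)`, a value in `[0, ∞]`. -/
def entropy {Ω : Type*} [MeasurableSpace Ω] (P : Measure Ω) {S : Type*} (X : Ω → S) : ℝ≥0∞ :=
  ∑' s, ENNReal.ofReal (Real.negMulLog (P.real (X ⁻¹' {s})) / Real.log 2)

/-- Conditional Shannon entropy of discrete random variables:
`H(X | Y) = ∑ₜ P(Y = t) H(X | Y = t)`, where `H(X | Y = t)` is the entropy of `X` under the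
conditional probability measure `P(· | Y = t)`. -/
def condEntropy {Ω : Type*} [MeasurableSpace Ω] (P : Measure Ω) {S T : Type*}
    (X : Ω → S) (Y : Ω → T) : ℝ≥0∞ :=
  ∑' t, P (Y ⁻¹' {t}) * entropy (ProbabilityTheory.cond P (Y ⁻¹' {t})) X

/-- A file: a binary vector of length `L`. -/
abbrev FileSpace (L : ℕ) : Type := Fin L → ZMod 2

/-- The files of the `r`-multigraph `G^(r)`: every edge `e` of the simple graph `G` carries the
`r` files `(e, 0), …, (e, r - 1)`. -/
abbrev FileIdx {V : Type} (G : SimpleGraph V) (r : ℕ) : Type := G.edgeSet × Fin r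

/-- Server `i` stores the file `f` iff `i` is an endpoint of the edge carrying `f`. -/
def Stores {V : Type} {G : SimpleGraph V} {r : ℕ} (i : V) (f : FileIdx G r) : Prop :=
  i ∈ (f.1 : Sym2 V)

/-- A private information retrieval scheme with file length `L` for the replication system of the
`r`-multigraph `G^(r)`, whose vertices are the servers. All query and answer alphabets are
discrete (finite or countably infinite). `Q θ i` and `A θ i` are the query to and the answer of
server `i` when the desired file is `θ`. -/
structure PIRScheme {V : Type} (G : SimpleGraph V) (r L : ℕ) where
  /-- the underlying probability space -/
  Ω : Type
  [mΩ : MeasurableSpace Ω]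
  P : Measure Ω
  [isProb : IsProbabilityMeasure P]
  /-- query alphabets -/
  Query : V → Type
  [mQuery : ∀ i, MeasurableSpace (Query i)]
  [countQuery : ∀ i, Countable (Query i)]
  [singQuery : ∀ i, MeasurableSingletonClass (Query i)]
  /-- answer alphabets -/
  Answer : V → Type
  [mAnswer : ∀ i, MeasurableSpace (Answer i)]
  [countAnswer : ∀ i, Countable (Answer i)]
  [singAnswer : ∀ i, MeasurableSingletonClass (Answer i)]
  /-- the files -/
  W : FileIdx G r → Ω → FileSpace L
  /-- the queries -/
  Q : FileIdx G r → (i : V) → Ω → Query i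
  /-- the answers -/
  A : FileIdx G r → (i : V) → Ω → Answer i
  measurable_W : ∀ f, Measurable (W f)
  measurable_Q : ∀ θ i, Measurable (Q θ i)
  measurable_A : ∀ θ i, Measurable (A θ i)
  /-- every file is uniform on `F₂^L` -/
  uniform_W : ∀ f, P.map (W f) = uniformOn Set.univ
  /-- the files are mutually independent -/
  indep_W : iIndepFun W P
  /-- the collection of all queries is independent of the collection of all files -/
  indep_W_Q : ∀ θ, IndepFun (fun ω f => W f ω) (fun ω i => Q θ i ω) P
  /-- `H(A_i | Q_i, W_{S_i}) = 0`: an answer is a function of the query and the stored files -/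
  answer_determined : ∀ θ i,
    condEntropy P (A θ i) (fun ω => (Q θ i ω, fun f : {f // Stores i f} => W f.1 ω)) = 0
  /-- reliability: `H(W_θ | A_{[N]}, Q_{[N]}) = 0` -/
  reliable : ∀ θ, condEntropy P (W θ) (fun ω => (fun i => A θ i ω, fun i => Q θ i ω)) = 0
  /-- privacy: the law of `(Q_i, A_i, W_{S_i})` does not depend on the desired file -/
  isPrivate : ∀ θ θ' i,
    IdentDistrib (fun ω => (Q θ i ω, A θ i ω, fun f : {f // Stores i f} => W f.1 ω))
      (fun ω => (Q θ' i ω, A θ' i ω, fun f : {f // Stores i f} => W f.1 ω)) P P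

attribute [instance] PIRScheme.mΩ PIRScheme.isProb PIRScheme.mQuery PIRScheme.countQuery
  PIRScheme.singQuery PIRScheme.mAnswer PIRScheme.countAnswer PIRScheme.singAnswer

namespace PIRScheme

variable {V : Type} {G : SimpleGraph V} {r L : ℕ}

/-- The download cost `∑ᵢ H(A_i)`. By privacy the law of every `A_i` is the same for all desired
files `θ`, so the supremum over `θ` is the common value. -/
def download [Fintype V] (T : PIRScheme G r L) : ℝ≥0∞ :=
  ⨆ θ, ∑ i, entropy T.P (T.A θ i)

/-- The rate `L / ∑ᵢ H(A_i)`. -/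
def rate [Fintype V] (T : PIRScheme G r L) : ℝ≥0∞ := (L : ℝ≥0∞) / T.download

/-- The symmetric retrieval property: for every desired file `θ`, and for both servers `i` that
store it, `H(A_i | Q_i, W_{S_i} ∖ {W_θ}) = L / 2`. -/
def SymmetricRetrieval (T : PIRScheme G r L) : Prop :=
  ∀ θ i, Stores i θ →
    condEntropy T.P (T.A θ i)
      (fun ω => (T.Q θ i ω, fun f : {f // Stores i f ∧ f ≠ θ} => T.W f.1 ω)) = (L : ℝ≥0∞) / 2

end PIRScheme

/-- The PIR capacity of `G^(r)`: the supremum of the rates of all schemes, over all positive file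
lengths. -/
def capacity {V : Type} [Fintype V] (G : SimpleGraph V) (r : ℕ) : ℝ≥0∞ :=
  ⨆ (L : ℕ) (_ : 0 < L) (T : PIRScheme G r L), T.rate

end MultigraphPIR

end

/-! Converse. Fix an edge `ab` and condition on every file off that edge. If the files in `T` are
known and `θ ∉ T` lies on the edge, the answers of `a` and `b` determine `W_θ`, so H(A_a|T) +
H(A_b|T) ≥ H(A_a,A_b|T) = L + H(A_a,A_b|T,θ) ≥ L + (H(A_a|T,θ) + H(A_b|T,θ))/2. Privacy makes each
single-server term independent of the desired file, so the step can be repeated for all `r` files of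
the edge, giving H(A_a) + H(A_b) ≥ L(1 + 1/2 + ⋯ + 2^(1-r)) = L(2 - 2^(1-r))
(`le_entropy_add_entropy`). A path on `N = 2m` vertices has a perfect matching, and summing over its
`m` edges bounds the rate (`rate_pathGraph_le`).

Achievability. Removing the desired edge cuts the path in two. Servers on one side receive a uniform
key, those on the other side a shifted key, and each answers with a sum over its incident edges.
Over characteristic 2, adding up the answers of one side cancels every edge except the cut one
(`sum_edgeSum_side`), so the two sides return two functions of the files on that edge, from which
the desired file is decoded (`cutScheme`). With keys in F₂^r used as coefficients and the shift by a
unit vector, the answer vanishes with the key, an event of probability 2^(-r), and is uniform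
otherwise. It costs (1 - 2^(-r))L + O(1) bits, and L → ∞ reaches the bound. With the key a bit
position in a file of length 2, every server sends one bit, which gives the symmetric scheme. -/

noncomputable section

namespace MultigraphPIR

/-! ### Entropy of functions on a finite uniform space. -/

section FiniteEntropy

variable {X S T U : Type*} [Fintype X]

open Classical in
/-- The number of points with the same image as `x`. -/
def fiberCard (f : X → S) (x : X) : ℕ := (Finset.univ.filter fun y => f y = f x).card

/-- The entropy, in nats, of a function on a finite type with the uniform distribution. -/
def unifEntropy (f : X → S) : ℝ :=
  (∑ x, Real.log (Fintype.card X / fiberCard f x)) / Fintype.card X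

lemma fiberCard_pos (f : X → S) (x : X) : 0 < fiberCard f x :=
  Finset.card_pos.2 ⟨x, by simp⟩

lemma fiberCard_eq_card [DecidableEq S] (f : X → S) (x : X) :
    fiberCard f x = (Finset.univ.filter fun y => f y = f x).card := by
  rw [fiberCard]
  congr

lemma fiberCard_le_of_refines {f : X → S} {g : X → T} (h : ∀ x y, g x = g y → f x = f y) (x : X) :
    fiberCard g x ≤ fiberCard f x := by
  classical
  refine Finset.card_le_card fun y hy => ?_
  simp only [Finset.mem_filter, Finset.mem_univ, true_and] at hy ⊢
  exact h _ _ hy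

lemma unifEntropy_mono {f : X → S} {g : X → T} (h : ∀ x y, g x = g y → f x = f y) :
    unifEntropy f ≤ unifEntropy g := by
  refine div_le_div_of_nonneg_right (Finset.sum_le_sum fun x _ => ?_) (Nat.cast_nonneg _)
  have hX : 0 < (Fintype.card X : ℝ) := Nat.cast_pos.2 (Fintype.card_pos_iff.2 ⟨x⟩)
  have hf : 0 < (fiberCard f x : ℝ) := Nat.cast_pos.2 (fiberCard_pos f x)
  have hg : 0 < (fiberCard g x : ℝ) := Nat.cast_pos.2 (fiberCard_pos g x)
  refine Real.log_le_log (by positivity) ?_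
  gcongr
  exact fiberCard_le_of_refines h x

lemma unifEntropy_congr {f : X → S} {g : X → T} (h : ∀ x y, f x = f y ↔ g x = g y) :
    unifEntropy f = unifEntropy g :=
  le_antisymm (unifEntropy_mono fun x y => (h x y).2) (unifEntropy_mono fun x y => (h x y).1)

/-- Expand the two fibres in the numerator as a sum over pairs `(y, z)` and sum over `x` first. For
fixed `(y, z)` the admissible `x` are either absent or form exactly one fibre of `(f, g, h)`, whose
size cancels `n x`; in the latter case also `h y = h z`. -/
lemma sum_fiberCard_ratio_le (f : X → S) (g : X → T) (h : X → U) :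
    ∑ x, ((fiberCard (fun x => (f x, h x)) x : ℝ) * fiberCard (fun x => (g x, h x)) x) /
      (fiberCard (fun x => (f x, g x, h x)) x * fiberCard h x) ≤ Fintype.card X := by
  classical
  set n := fiberCard (fun x => (f x, g x, h x)) with hn
  calc
    _ = ∑ x, ∑ y, ∑ z, if ((f y, h y) = (f x, h x) ∧ (g z, h z) = (g x, h x)) then
          (1 / (n x * fiberCard h x) : ℝ) else 0 := by
        refine Finset.sum_congr rfl fun x _ => ?_
        rw [div_eq_mul_one_div, fiberCard, fiberCard, Finset.card_filter, Finset.card_filter,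
          Nat.cast_sum, Nat.cast_sum, Finset.sum_mul_sum, Finset.sum_mul]
        refine Finset.sum_congr rfl fun y _ => ?_
        rw [Finset.sum_mul]
        refine Finset.sum_congr rfl fun z _ => ?_
        by_cases h1 : (f y, h y) = (f x, h x) <;> by_cases h2 : (g z, h z) = (g x, h x) <;>
          simp only [h1, h2, if_true, if_false, true_and, false_and, Nat.cast_one, Nat.cast_zero,
            one_mul, zero_mul, mul_zero]
    _ = ∑ y, ∑ z, ∑ x, if ((f y, h y) = (f x, h x) ∧ (g z, h z) = (g x, h x)) then
          (1 / (n x * fiberCard h x) : ℝ) else 0 := by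
        rw [Finset.sum_comm]
        exact Finset.sum_congr rfl fun y _ => Finset.sum_comm
    _ ≤ ∑ y, ∑ z, if h z = h y then (1 / fiberCard h y : ℝ) else 0 := by
        refine Finset.sum_le_sum fun y _ => Finset.sum_le_sum fun z _ => ?_
        rw [← Finset.sum_filter]
        rcases Finset.eq_empty_or_nonempty (Finset.univ.filter fun x =>
          (f y, h y) = (f x, h x) ∧ (g z, h z) = (g x, h x)) with h0 | ⟨x₀, h0⟩
        · rw [h0, Finset.sum_empty]
          positivity
        · simp only [Prod.mk.injEq, Finset.mem_filter, Finset.mem_univ, true_and] at h0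
          obtain ⟨⟨h1, h2⟩, h3, h4⟩ := h0
          have hs : (Finset.univ.filter fun x =>
              (f y, h y) = (f x, h x) ∧ (g z, h z) = (g x, h x)) =
              Finset.univ.filter fun x => (f x, g x, h x) = (f x₀, g x₀, h x₀) := by
            ext x
            simp only [Finset.mem_filter, Finset.mem_univ, true_and, Prod.mk.injEq, h1, h2, h3, h4]
            grind
          have hconst : ∀ x ∈ Finset.univ.filter fun x =>
              (f x, g x, h x) = (f x₀, g x₀, h x₀),
              (1 / (n x * fiberCard h x) : ℝ) = 1 / (n x₀ * fiberCard h x₀) := by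
            intro x hx
            simp only [Finset.mem_filter, Finset.mem_univ, true_and] at hx
            have e1 : n x = n x₀ := by rw [hn, fiberCard_eq_card, fiberCard_eq_card, hx]
            have e2 : fiberCard h x = fiberCard h x₀ := by
              simp only [Prod.mk.injEq] at hx
              simp only [fiberCard, hx.2.2]
            rw [e1, e2]
          have hpos : (0 : ℝ) < n x₀ := Nat.cast_pos.2 (fiberCard_pos _ _)
          have hpos' : (0 : ℝ) < fiberCard h x₀ := Nat.cast_pos.2 (fiberCard_pos _ _)
          have e3 : fiberCard h y = fiberCard h x₀ := by simp only [fiberCard, h2]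
          rw [hs, Finset.sum_congr rfl hconst, Finset.sum_const, if_pos (h4.trans h2.symm), e3,
            ← fiberCard_eq_card, nsmul_eq_mul]
          apply le_of_eq
          rw [← hn]
          field_simp
    _ = ∑ y : X, (1 : ℝ) := by
        refine Finset.sum_congr rfl fun y _ => ?_
        have hpos : (0 : ℝ) < fiberCard h y := Nat.cast_pos.2 (fiberCard_pos _ _)
        rw [← Finset.sum_filter, Finset.sum_const, nsmul_eq_mul]
        change (fiberCard h y : ℝ) * _ = _
        field_simp
    _ = Fintype.card X := by simp

/-- Strong subadditivity of entropy. -/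
lemma unifEntropy_submodular (f : X → S) (g : X → T) (h : X → U) :
    unifEntropy (fun x => (f x, g x, h x)) + unifEntropy h ≤
      unifEntropy (fun x => (f x, h x)) + unifEntropy (fun x => (g x, h x)) := by
  unfold unifEntropy
  rw [← add_div, ← add_div, ← Finset.sum_add_distrib, ← Finset.sum_add_distrib]
  refine div_le_div_of_nonneg_right ?_ (Nat.cast_nonneg _)
  rw [← sub_nonneg, ← Finset.sum_sub_distrib]
  have key := sum_fiberCard_ratio_le f g h
  have hX : ∑ x : X, (1 : ℝ) = Fintype.card X := by simp
  rw [← hX, ← sub_nonneg, ← Finset.sum_sub_distrib] at key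
  refine key.trans (Finset.sum_le_sum fun x _ => ?_)
  have h0 : 0 < (Fintype.card X : ℝ) := Nat.cast_pos.2 (Fintype.card_pos_iff.2 ⟨x⟩)
  have h1 : (0 : ℝ) < fiberCard (fun x => (f x, h x)) x := Nat.cast_pos.2 (fiberCard_pos _ _)
  have h2 : (0 : ℝ) < fiberCard (fun x => (g x, h x)) x := Nat.cast_pos.2 (fiberCard_pos _ _)
  have h3 : (0 : ℝ) < fiberCard (fun x => (f x, g x, h x)) x := Nat.cast_pos.2 (fiberCard_pos _ _)
  have h4 : (0 : ℝ) < fiberCard h x := Nat.cast_pos.2 (fiberCard_pos _ _)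
  -- Jensen's inequality in the form log t ≤ t - 1; the ratios `t` sum to at most `|X|` by `key`.
  have hlog := Real.log_le_sub_one_of_pos (div_pos (mul_pos h1 h2) (mul_pos h3 h4))
  rw [Real.log_div (by positivity) (by positivity), Real.log_mul h1.ne' h2.ne',
    Real.log_mul h3.ne' h4.ne'] at hlog
  rw [Real.log_div h0.ne' h1.ne', Real.log_div h0.ne' h2.ne', Real.log_div h0.ne' h3.ne',
    Real.log_div h0.ne' h4.ne']
  linarith

lemma unifEntropy_eq_zero_of_const [Nonempty X] (f : X → S) (h : ∀ x y, f x = f y) :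
    unifEntropy f = 0 := by
  classical
  have : ∀ x, fiberCard f x = Fintype.card X := fun x => by
    rw [fiberCard, Finset.filter_true_of_mem fun y _ => h y x, Finset.card_univ]
  simp [unifEntropy, this]

/-- Grouping points by value turns the pointwise average, suited to inequalities, into Shannon's
formula, suited to concavity in the distribution. -/
lemma unifEntropy_eq_sum [DecidableEq S] (f : X → S) :
    unifEntropy f = ∑ s ∈ Finset.univ.image f,
      Real.negMulLog ((Finset.univ.filter fun x => f x = s).card / Fintype.card X) := by
  have := Finset.sum_comp (s := (Finset.univ : Finset X)) (fun s => Real.log (Fintype.card X /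
    ((Finset.univ.filter fun x => f x = s).card : ℝ))) f
  unfold unifEntropy
  simp_rw [fiberCard_eq_card]
  rw [this, Finset.sum_div]
  refine Finset.sum_congr rfl fun s _ => ?_
  rw [Real.negMulLog, nsmul_eq_mul]
  rw [← neg_mul_eq_neg_mul, ← mul_neg, ← Real.log_inv, inv_div]
  ring

end FiniteEntropy

/-! ### Conditioning on a set of independent uniform coordinates. -/

section Restriction

variable {F M : Type*} [Fintype F] [DecidableEq F] [Fintype M]

/-- The conditional entropy, in nats, of a function of independent uniform variables indexed by `F`
given the variables with index in `T`. -/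
def entropyGiven {S : Type*} (g : (F → M) → S) (T : Set F) : ℝ :=
  unifEntropy (fun w => (g w, T.domRestrict w)) - unifEntropy (fun w : F → M => T.domRestrict w)

open Classical in
lemma fiberCard_domRestrict (T : Set F) (w : F → M) :
    fiberCard (fun w : F → M => T.domRestrict w) w =
      ∏ f, if f ∈ T then 1 else Fintype.card M := by
  have : (Finset.univ.filter fun w' : F → M => T.domRestrict w' = T.domRestrict w) =
      Fintype.piFinset fun f => if f ∈ T then {w f} else Finset.univ := by
    ext w'
    simp only [Finset.mem_filter, Finset.mem_univ, true_and, Fintype.mem_piFinset, funext_iff,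
      Subtype.forall]
    refine forall_congr' fun f => ?_
    by_cases hf : f ∈ T <;> simp [hf, Set.domRestrict]
  rw [fiberCard_eq_card, this, Fintype.card_piFinset]
  refine Finset.prod_congr rfl fun f _ => ?_
  split_ifs <;> simp

/-- Fixing one more coordinate shrinks every fibre by the factor `|M|`. -/
lemma unifEntropy_domRestrict_insert [Nonempty M] {T : Set F} {θ : F} (hθ : θ ∉ T) :
    unifEntropy (fun w : F → M => (insert θ T).domRestrict w) =
      unifEntropy (fun w : F → M => T.domRestrict w) + Real.log (Fintype.card M) := by
  classical
  have hcard : ∀ w : F → M, fiberCard (fun w : F → M => T.domRestrict w) w =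
      Fintype.card M * fiberCard (fun w : F → M => (insert θ T).domRestrict w) w := by
    intro w
    rw [fiberCard_domRestrict, fiberCard_domRestrict, ← Finset.mul_prod_erase _ _ (Finset.mem_univ θ)]
    conv_rhs => rw [← Finset.mul_prod_erase _ _ (Finset.mem_univ θ)]
    simp only [hθ, if_false, Set.mem_insert_iff, true_or, if_true, one_mul]
    congr 1
    refine Finset.prod_congr rfl fun f hf => ?_
    simp [Finset.ne_of_mem_erase hf]
  have hM : 0 < (Fintype.card M : ℝ) := Nat.cast_pos.2 Fintype.card_pos
  have hX : 0 < (Fintype.card (F → M) : ℝ) := Nat.cast_pos.2 Fintype.card_pos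
  unfold unifEntropy
  rw [div_add' _ _ _ hX.ne']
  congr 1
  rw [← nsmul_eq_mul', ← Finset.card_univ, ← Finset.sum_const, ← Finset.sum_add_distrib]
  refine Finset.sum_congr rfl fun w _ => ?_
  have h4 : (0 : ℝ) < fiberCard (fun w : F → M => (insert θ T).domRestrict w) w :=
    Nat.cast_pos.2 (fiberCard_pos _ _)
  rw [hcard, Nat.cast_mul, Finset.card_univ, Real.log_div hX.ne' h4.ne',
    Real.log_div hX.ne' (by positivity), Real.log_mul hM.ne' h4.ne']
  ring

lemma entropyGiven_nonneg {S : Type*} (g : (F → M) → S) (T : Set F) : 0 ≤ entropyGiven g T :=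
  sub_nonneg.2 (unifEntropy_mono fun _ _ h => (Prod.ext_iff.1 h).2)

lemma entropyGiven_le [Nonempty M] {S : Type*} (g : (F → M) → S) (T : Set F) :
    entropyGiven g T ≤ unifEntropy g := by
  have h := unifEntropy_submodular g (fun w : F → M => T.domRestrict w) (fun _ => ())
  rw [unifEntropy_eq_zero_of_const (fun _ : F → M => ()) (fun _ _ => rfl), add_zero] at h
  rw [entropyGiven, sub_le_iff_le_add]
  convert h using 1
  · exact unifEntropy_congr fun _ _ => by simp
  · congr 1 <;> exact unifEntropy_congr fun _ _ => by simp

/-- One step of the converse: if `g₁, g₂` and the variables in `T` determine the variable `θ`. -/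
lemma entropyGiven_insert_le [Nonempty M] {S₁ S₂ : Type*} (g₁ : (F → M) → S₁) (g₂ : (F → M) → S₂)
    {T : Set F} {θ : F} (hθ : θ ∉ T)
    (hdec : ∀ w w', T.domRestrict w = T.domRestrict w' → g₁ w = g₁ w' → g₂ w = g₂ w' → w θ = w' θ) :
    Real.log (Fintype.card M) +
      (entropyGiven g₁ (insert θ T) + entropyGiven g₂ (insert θ T)) / 2 ≤
      entropyGiven g₁ T + entropyGiven g₂ T := by
  have hsub := unifEntropy_submodular g₁ g₂ (fun w : F → M => T.domRestrict w)
  have hins : ∀ w w' : F → M, (insert θ T).domRestrict w = (insert θ T).domRestrict w' ↔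
      w θ = w' θ ∧ T.domRestrict w = T.domRestrict w' := by
    intro w w'
    simp [funext_iff, Set.domRestrict]
  have hjoint : unifEntropy (fun w => (g₁ w, g₂ w, T.domRestrict w)) =
      unifEntropy (fun w => (g₁ w, g₂ w, (insert θ T).domRestrict w)) :=
    unifEntropy_congr fun w w' => by
      simp only [Prod.mk.injEq, hins]
      exact ⟨fun h => ⟨h.1, h.2.1, hdec _ _ h.2.2 h.1 h.2.1, h.2.2⟩,
        fun h => ⟨h.1, h.2.1, h.2.2.2⟩⟩
  -- The joint entropy dominates each of the two single entropies, hence their average: this is the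
  -- source of the factor 1/2.
  have h1 : unifEntropy (fun w => (g₁ w, (insert θ T).domRestrict w)) ≤
      unifEntropy (fun w => (g₁ w, g₂ w, (insert θ T).domRestrict w)) :=
    unifEntropy_mono fun w w' => by
      simp only [Prod.mk.injEq]
      tauto
  have h2 : unifEntropy (fun w => (g₂ w, (insert θ T).domRestrict w)) ≤
      unifEntropy (fun w => (g₁ w, g₂ w, (insert θ T).domRestrict w)) :=
    unifEntropy_mono fun w w' => by
      simp only [Prod.mk.injEq]
      tauto
  have h3 := unifEntropy_domRestrict_insert (M := M) hθ
  unfold entropyGiven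
  linarith

end Restriction

/-! ### Discrete entropy: zero conditional entropy and concavity. -/

section Discrete

variable {Ω : Type*} [MeasurableSpace Ω] {P : Measure Ω}

lemma exists_measure_eq_one_of_entropy_eq_zero [IsProbabilityMeasure P] {S : Type*} [Countable S]
    {X : Ω → S} (h : entropy P X = 0) : ∃ s, P (X ⁻¹' {s}) = 1 := by
  rw [entropy, ENNReal.tsum_eq_zero] at h
  have hs : ∃ s, P (X ⁻¹' {s}) ≠ 0 := by
    by_contra! h0
    have h1 : P (⋃ s, X ⁻¹' {s}) = 0 := measure_iUnion_null h0
    rw [← Set.preimage_iUnion, Set.iUnion_of_singleton, Set.preimage_univ, measure_univ] at h1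
    exact one_ne_zero h1
  obtain ⟨s, hs⟩ := hs
  refine ⟨s, ?_⟩
  have h2 := h s
  rw [ENNReal.ofReal_eq_zero] at h2
  have hlog : 0 < Real.log 2 := Real.log_pos one_lt_two
  have h3 : Real.negMulLog (P.real (X ⁻¹' {s})) ≤ 0 := by
    by_contra! h4
    exact absurd h2 (not_le.2 (div_pos h4 hlog))
  have hpos : 0 < P.real (X ⁻¹' {s}) := ENNReal.toReal_pos hs (measure_ne_top _ _)
  have hle : P.real (X ⁻¹' {s}) ≤ 1 := measureReal_le_one
  have h5 : P.real (X ⁻¹' {s}) = 1 := by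
    by_contra hne
    have := Real.log_neg hpos (lt_of_le_of_ne hle hne)
    rw [Real.negMulLog] at h3
    nlinarith
  rw [← ENNReal.toReal_eq_one_iff]
  exact h5

/-- If `H(X | Y) = 0` then `X` is almost surely a function of `Y`. -/
lemma exists_ae_eq_of_condEntropy_eq_zero [IsProbabilityMeasure P] {S T : Type*}
    [Countable S] [Countable T] [MeasurableSpace S] [MeasurableSpace T]
    [MeasurableSingletonClass S] [MeasurableSingletonClass T] {X : Ω → S} {Y : Ω → T}
    (hX : Measurable X) (hY : Measurable Y) (h : condEntropy P X Y = 0) :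
    ∃ g : T → S, ∀ᵐ ω ∂P, X ω = g (Y ω) := by
  have hne : Nonempty S := (nonempty_of_isProbabilityMeasure P).map X
  rw [condEntropy, ENNReal.tsum_eq_zero] at h
  have key : ∀ t, ∃ s, P (Y ⁻¹' {t} ∩ (X ⁻¹' {s})ᶜ) = 0 := by
    intro t
    rcases mul_eq_zero.1 (h t) with h0 | h0
    · exact ⟨Classical.arbitrary S, measure_mono_null Set.inter_subset_left h0⟩
    · by_cases hP : P (Y ⁻¹' {t}) = 0
      · exact ⟨Classical.arbitrary S, measure_mono_null Set.inter_subset_left hP⟩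
      have := cond_isProbabilityMeasure hP
      obtain ⟨s, hs⟩ := exists_measure_eq_one_of_entropy_eq_zero h0
      refine ⟨s, ?_⟩
      have h1 := (prob_compl_eq_zero_iff (hX (measurableSet_singleton s))).2 hs
      rw [cond_apply (hY (measurableSet_singleton t))] at h1
      exact (mul_eq_zero.1 h1).resolve_left (ENNReal.inv_ne_zero.2 (measure_ne_top _ _))
  choose g hg using key
  refine ⟨g, ?_⟩
  rw [ae_iff]
  refine measure_mono_null (fun ω hω => ?_) (measure_iUnion_null hg)
  exact Set.mem_iUnion.2 ⟨Y ω, rfl, hω⟩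

/-- Concavity of entropy, for a mixture of images of uniform distributions. -/
lemma lintegral_unifEntropy_le_entropy {Ω' : Type*} [MeasurableSpace Ω'] {P' : Measure Ω'}
    [IsProbabilityMeasure P'] {S K X : Type*} [Countable S] [Countable K] [MeasurableSpace K]
    [MeasurableSingletonClass K] [DecidableEq S] [Fintype X] {A : Ω → S} {Y : Ω' → K}
    (hY : Measurable Y) (f : K → X → S)
    (hA : ∀ s, P.real (A ⁻¹' {s}) =
      ∫ ω, ((Finset.univ.filter fun x => f (Y ω) x = s).card / Fintype.card X : ℝ) ∂P') :
    ∫⁻ ω, ENNReal.ofReal (unifEntropy (f (Y ω)) / Real.log 2) ∂P' ≤ entropy P A := by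
  classical
  have hlog : 0 < Real.log 2 := Real.log_pos one_lt_two
  set p : K → S → ℝ := fun k s =>
    (Finset.univ.filter fun x => f k x = s).card / Fintype.card X with hp
  have hp0 : ∀ k s, 0 ≤ p k s := fun k s => by positivity
  have hp1 : ∀ k s, p k s ≤ 1 := fun k s =>
    div_le_one_of_le₀ (Nat.cast_le.2 (Finset.card_le_univ _)) (Nat.cast_nonneg _)
  have hmeas : ∀ φ : K → ℝ, Measurable fun ω => φ (Y ω) := fun φ =>
    (Measurable.of_discrete (f := φ)).comp hY
  have hφ0 : ∀ k s, 0 ≤ Real.negMulLog (p k s) := fun k s =>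
    Real.negMulLog_nonneg (hp0 k s) (hp1 k s)
  have hφ1 : ∀ k s, Real.negMulLog (p k s) ≤ 1 := fun k s => by
    have h := Real.negMulLog_le_one_sub_self (hp0 k s)
    linarith [hp0 k s]
  have hint : ∀ s, Integrable (fun ω => p (Y ω) s) P' := fun s =>
    Integrable.of_bound (hmeas fun k => p k s).aestronglyMeasurable 1
      (Filter.Eventually.of_forall fun ω => by
        rw [Real.norm_of_nonneg (hp0 _ _)]
        exact hp1 _ _)
  have hint' : ∀ s, Integrable (fun ω => Real.negMulLog (p (Y ω) s)) P' := fun s =>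
    Integrable.of_bound (hmeas fun k => Real.negMulLog (p k s)).aestronglyMeasurable 1
      (Filter.Eventually.of_forall fun ω => by
        rw [Real.norm_of_nonneg (hφ0 _ _)]
        exact hφ1 _ _)
  have hsum : ∀ k, ENNReal.ofReal (unifEntropy (f k) / Real.log 2) =
      ∑' s, ENNReal.ofReal (Real.negMulLog (p k s) / Real.log 2) := by
    intro k
    rw [tsum_eq_sum (s := Finset.univ.image (f k)), unifEntropy_eq_sum, Finset.sum_div,
      ENNReal.ofReal_sum_of_nonneg]
    · exact fun s _ => div_nonneg (hφ0 k s) hlog.le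
    · intro s hs
      have : (Finset.univ.filter fun x => f k x = s) = ∅ := by
        refine Finset.filter_eq_empty_iff.2 fun x _ hx => hs ?_
        exact Finset.mem_image.2 ⟨x, Finset.mem_univ _, hx⟩
      simp [hp, this]
  simp_rw [hsum]
  rw [lintegral_tsum fun s => (((hmeas fun k =>
    Real.negMulLog (p k s) / Real.log 2)).ennreal_ofReal).aemeasurable, entropy]
  refine ENNReal.tsum_le_tsum fun s => ?_
  rw [← ofReal_integral_eq_lintegral_ofReal ((hint' s).div_const _)
    (Filter.Eventually.of_forall fun ω => div_nonneg (hφ0 _ _) hlog.le), integral_div, hA]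
  refine ENNReal.ofReal_le_ofReal (div_le_div_of_nonneg_right ?_ hlog.le)
  -- Jensen's inequality for -x log x, separately for each value `s`.
  exact Real.concaveOn_negMulLog.le_map_integral Real.continuous_negMulLog.continuousOn isClosed_Ici
    (Filter.Eventually.of_forall fun ω => hp0 _ _) (hint s) (hint' s)

lemma uniformOn_univ_real {X : Type*} [Fintype X] [MeasurableSpace X] [MeasurableSingletonClass X]
    (p : X → Prop) [DecidablePred p] :
    (uniformOn Set.univ : Measure X).real {x | p x} =
      (Finset.univ.filter p).card / Fintype.card X := by
  rw [Measure.real, uniformOn_univ, ENNReal.toReal_div, ENNReal.toReal_natCast,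
    ← Finset.coe_filter_univ, Measure.count_apply_finset, ENNReal.toReal_natCast]

lemma entropy_comp_measurePreserving {Ω' : Type*} [MeasurableSpace Ω'] {P' : Measure Ω'} {S : Type*}
    [MeasurableSpace S] [MeasurableSingletonClass S] {X : Ω' → S} (hX : Measurable X) {Φ : Ω → Ω'}
    (hΦ : MeasurePreserving Φ P P') : entropy P (fun ω => X (Φ ω)) = entropy P' X := by
  unfold entropy
  refine tsum_congr fun s => ?_
  rw [Measure.real, Measure.real,
    ← hΦ.measure_preimage (hX (measurableSet_singleton s)).nullMeasurableSet]
  rfl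

end Discrete

/-! ### Schemes seen through a fixed realization of the queries. -/

namespace PIRScheme

variable {V : Type} {G : SimpleGraph V} {r L : ℕ}

lemma measurable_files [Finite V] (T : PIRScheme G r L) : Measurable fun ω f => T.W f ω :=
  measurable_pi_lambda _ T.measurable_W

lemma measurable_queries (T : PIRScheme G r L) (θ : FileIdx G r) :
    Measurable fun ω i => T.Q θ i ω :=
  measurable_pi_lambda _ (T.measurable_Q θ)

lemma map_files [Finite V] (T : PIRScheme G r L) :
    T.P.map (fun ω f => T.W f ω) = uniformOn Set.univ := by
  have : Fintype (FileIdx G r) := Fintype.ofFinite _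
  rw [(iIndepFun_iff_map_fun_eq_pi_map fun f => (T.measurable_W f).aemeasurable).1 T.indep_W]
  simp_rw [T.uniform_W]
  rw [← uniformOn_pi, Set.pi_univ]

lemma map_queries_files [Finite V] (T : PIRScheme G r L) (θ : FileIdx G r) :
    T.P.map (fun ω => (fun i => T.Q θ i ω, fun f => T.W f ω)) =
      (T.P.map fun ω i => T.Q θ i ω).prod (uniformOn Set.univ) := by
  rw [← T.map_files]
  exact (indepFun_iff_map_prod_eq_prod_map_map (T.measurable_queries θ).aemeasurable
    T.measurable_files.aemeasurable).1 (T.indep_W_Q θ).symm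

lemma map_query_files [Finite V] (T : PIRScheme G r L) (θ : FileIdx G r) (i : V) :
    T.P.map (fun ω => (T.Q θ i ω, fun f => T.W f ω)) =
      (T.P.map (T.Q θ i)).prod (uniformOn Set.univ) := by
  rw [← T.map_files]
  exact (indepFun_iff_map_prod_eq_prod_map_map (T.measurable_Q θ i).aemeasurable
    T.measurable_files.aemeasurable).1 ((T.indep_W_Q θ).symm.comp (measurable_pi_apply i)
      measurable_id)

/-- The answers are deterministic functions of the query and the stored files, and by privacy these
functions can be chosen independently of the desired file. -/
lemma exists_answer_function [Finite V] (T : PIRScheme G r L) (θ₀ : FileIdx G r) (i : V) :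
    ∃ f : T.Query i → ({f : FileIdx G r // Stores i f} → FileSpace L) → T.Answer i,
      ∀ θ, ∀ᵐ ω ∂T.P, T.A θ i ω = f (T.Q θ i ω) (fun j => T.W j.1 ω) := by
  have hm : ∀ θ, Measurable fun ω => (T.Q θ i ω, fun f : {f // Stores i f} => T.W f.1 ω) :=
    fun θ => (T.measurable_Q θ i).prodMk (measurable_pi_lambda _ fun f => T.measurable_W f.1)
  obtain ⟨g, hg⟩ := exists_ae_eq_of_condEntropy_eq_zero (T.measurable_A θ₀ i) (hm θ₀)
    (T.answer_determined θ₀ i)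
  refine ⟨fun q w => g (q, w), fun θ => ?_⟩
  have h := (T.isPrivate θ₀ θ i).ae_snd
    (p := fun x => x.2.1 = g (x.1, x.2.2)) (MeasurableSet.of_discrete) hg
  exact h

/-- For almost every realization of the queries, the answers determine the desired file. -/
lemma ae_decodable [Finite V] (T : PIRScheme G r L)
    {f : ∀ i, T.Query i → ({f : FileIdx G r // Stores i f} → FileSpace L) → T.Answer i}
    (hf : ∀ i θ, ∀ᵐ ω ∂T.P, T.A θ i ω = f i (T.Q θ i ω) (fun j => T.W j.1 ω)) (θ : FileIdx G r) :
    ∀ᵐ ω ∂T.P, ∀ w w' : FileIdx G r → FileSpace L,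
      (∀ i, f i (T.Q θ i ω) (fun j => w j.1) = f i (T.Q θ i ω) (fun j => w' j.1)) →
        w θ = w' θ := by
  have hm : Measurable fun ω => (fun i => T.A θ i ω, fun i => T.Q θ i ω) :=
    (measurable_pi_lambda _ (T.measurable_A θ)).prodMk (T.measurable_queries θ)
  obtain ⟨g, hg⟩ := exists_ae_eq_of_condEntropy_eq_zero (T.measurable_W θ) hm (T.reliable θ)
  have h1 : ∀ᵐ ω ∂T.P, T.W θ ω =
      g (fun i => f i (T.Q θ i ω) (fun j => T.W j.1 ω), fun i => T.Q θ i ω) := by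
    filter_upwards [hg, ae_all_iff.2 fun i => hf i θ] with ω h1 h2
    rw [h1]
    simp_rw [h2]
  have hm2 : Measurable fun ω => ((fun i => T.Q θ i ω : ∀ i, T.Query i), fun f => T.W f ω) :=
    (T.measurable_queries θ).prodMk T.measurable_files
  have h2 : ∀ᵐ x ∂(T.P.map fun ω => ((fun i => T.Q θ i ω : ∀ i, T.Query i), fun f => T.W f ω)),
      x.2 θ = g (fun i => f i (x.1 i) (fun j => x.2 j.1), x.1) := by
    rw [ae_map_iff hm2.aemeasurable MeasurableSet.of_discrete]
    exact h1
  -- Queries and files have a product law, so by Fubini decoding works for almost all files at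
  -- almost every query. The uniform law charges every file vector, so "almost all files" becomes
  -- "all files".
  rw [T.map_queries_files θ] at h2
  have h3 := ae_of_ae_map (T.measurable_queries θ).aemeasurable (Measure.ae_ae_of_ae_prod h2)
  filter_upwards [h3] with ω hω w w' hw
  have : Fintype (FileIdx G r) := Fintype.ofFinite _
  classical
  rw [ae_iff_of_countable] at hω
  have hpos : ∀ w : FileIdx G r → FileSpace L,
      (uniformOn Set.univ : Measure (FileIdx G r → FileSpace L)) {w} ≠ 0 := by
    intro w
    rw [Ne, uniformOn_eq_zero_iff Set.finite_univ]
    simp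
  rw [hω w (hpos w), hω w' (hpos w')]
  simp_rw [hw]

/-- The entropy, in bits, of the answer of server `i` given its query and the files in `S`. -/
def answerEntropyGiven [Fintype (FileIdx G r)] [DecidableEq (FileIdx G r)] (T : PIRScheme G r L)
    (f : ∀ i, T.Query i → ({f : FileIdx G r // Stores i f} → FileSpace L) → T.Answer i)
    (θ : FileIdx G r) (i : V) (S : Set (FileIdx G r)) : ℝ≥0∞ :=
  ∫⁻ ω, ENNReal.ofReal
    (entropyGiven (fun w => f i (T.Q θ i ω) (fun j => w j.1)) S / Real.log 2) ∂T.P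

variable [Fintype (FileIdx G r)] [DecidableEq (FileIdx G r)]

/-- The integrand depends only on the query to server `i`, whose law is the same for all desired
files. This lets each step of the converse aim at a different file. -/
lemma answerEntropyGiven_eq (T : PIRScheme G r L)
    (f : ∀ i, T.Query i → ({f : FileIdx G r // Stores i f} → FileSpace L) → T.Answer i)
    (θ θ' : FileIdx G r) (i : V) (S : Set (FileIdx G r)) :
    T.answerEntropyGiven f θ i S = T.answerEntropyGiven f θ' i S :=
  ((T.isPrivate θ θ' i).comp
    (u := fun x => ENNReal.ofReal
      (entropyGiven (fun w => f i x.1 (fun j => w j.1)) S / Real.log 2))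
    ((Measurable.of_discrete (f := fun q => ENNReal.ofReal
      (entropyGiven (fun w => f i q (fun j => w j.1)) S / Real.log 2))).comp
        measurable_fst)).lintegral_eq

/-- Two losses are combined: for each fixed query, conditioning on files lowers entropy; averaging
over queries lowers it again by concavity. -/
lemma answerEntropyGiven_le [Finite V] (T : PIRScheme G r L)
    {f : ∀ i, T.Query i → ({f : FileIdx G r // Stores i f} → FileSpace L) → T.Answer i}
    (hf : ∀ i θ, ∀ᵐ ω ∂T.P, T.A θ i ω = f i (T.Q θ i ω) (fun j => T.W j.1 ω)) (θ : FileIdx G r)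
    (i : V) (S : Set (FileIdx G r)) :
    T.answerEntropyGiven f θ i S ≤ entropy T.P (T.A θ i) := by
  classical
  have hlog : 0 < Real.log 2 := Real.log_pos one_lt_two
  refine (lintegral_mono fun ω => ENNReal.ofReal_le_ofReal
    (div_le_div_of_nonneg_right (entropyGiven_le _ _) hlog.le)).trans
    (lintegral_unifEntropy_le_entropy (T.measurable_Q θ i)
      (fun q (w : FileIdx G r → FileSpace L) => f i q (fun j => w j.1)) fun s => ?_)
  have hm : Measurable fun ω => (T.Q θ i ω, fun f => T.W f ω) :=
    (T.measurable_Q θ i).prodMk T.measurable_files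
  have h1 : T.P (T.A θ i ⁻¹' {s}) = ∫⁻ ω, (uniformOn Set.univ : Measure (FileIdx G r → FileSpace L))
      {w | f i (T.Q θ i ω) (fun j => w j.1) = s} ∂T.P := by
    have hset : T.P (T.A θ i ⁻¹' {s}) = T.P ((fun ω => (T.Q θ i ω, fun f => T.W f ω)) ⁻¹'
        {x | f i x.1 (fun j => x.2 j.1) = s}) := by
      refine measure_congr ?_
      filter_upwards [hf i θ] with ω hω
      exact congrArg (· = s) hω
    rw [hset, ← Measure.map_apply hm MeasurableSet.of_discrete, T.map_query_files,
      Measure.prod_apply MeasurableSet.of_discrete,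
      lintegral_map Measurable.of_discrete (T.measurable_Q θ i)]
    rfl
  rw [Measure.real, h1, ← integral_toReal]
  · refine integral_congr_ae (Filter.Eventually.of_forall fun ω => ?_)
    exact uniformOn_univ_real fun w : FileIdx G r → FileSpace L =>
      f i (T.Q θ i ω) (fun j => w j.1) = s
  · exact ((Measurable.of_discrete (f := fun q =>
      (uniformOn Set.univ : Measure (FileIdx G r → FileSpace L))
      {w | f i q (fun j => w j.1) = s})).comp (T.measurable_Q θ i)).aemeasurable
  · exact Filter.Eventually.of_forall fun ω => measure_lt_top _ _

/-- `entropyGiven_insert_le` integrated over the queries. Once the files in `S` are fixed, every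
server other than `a`, `b` has a fixed answer, so decodability rests on these two alone. -/
lemma answerEntropyGiven_insert_le [Finite V] (T : PIRScheme G r L)
    {f : ∀ i, T.Query i → ({f : FileIdx G r // Stores i f} → FileSpace L) → T.Answer i}
    (hf : ∀ i θ, ∀ᵐ ω ∂T.P, T.A θ i ω = f i (T.Q θ i ω) (fun j => T.W j.1 ω)) {θ : FileIdx G r}
    {a b : V} {S : Set (FileIdx G r)} (hθ : θ ∉ S)
    (hS : ∀ i, i ≠ a → i ≠ b → ∀ f : FileIdx G r, Stores i f → f ∈ S) :
    (L : ℝ≥0∞) + (T.answerEntropyGiven f θ a (insert θ S) +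
      T.answerEntropyGiven f θ b (insert θ S)) / 2 ≤
      T.answerEntropyGiven f θ a S + T.answerEntropyGiven f θ b S := by
  have hlog : 0 < Real.log 2 := Real.log_pos one_lt_two
  have hmeas : ∀ i S, Measurable fun ω => ENNReal.ofReal
      (entropyGiven (fun w => f i (T.Q θ i ω) (fun j => w j.1)) S / Real.log 2) := fun i S =>
    (Measurable.of_discrete (f := fun q => ENNReal.ofReal
      (entropyGiven (fun w => f i q (fun j => w j.1)) S / Real.log 2))).comp (T.measurable_Q θ i)
  have hL : ∫⁻ _, (L : ℝ≥0∞) ∂T.P = L := by simp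
  unfold answerEntropyGiven
  rw [← lintegral_add_left (hmeas a _), ← lintegral_add_left (hmeas a _), ENNReal.div_eq_inv_mul,
    ← lintegral_const_mul _ ((hmeas a _).fun_add (hmeas b _)), ← hL,
    ← lintegral_add_left measurable_const]
  refine lintegral_mono_ae ?_
  filter_upwards [T.ae_decodable hf θ] with ω hω
  have key := entropyGiven_insert_le (fun w => f a (T.Q θ a ω) (fun j => w j.1))
    (fun w => f b (T.Q θ b ω) (fun j => w j.1)) hθ fun w w' h0 h1 h2 => by
      refine hω w w' fun i => ?_
      by_cases ha : i = a
      · subst ha; exact h1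
      by_cases hb : i = b
      · subst hb; exact h2
      congr 1
      funext j
      exact congrFun h0 ⟨j.1, hS i ha hb j.1 j.2⟩
  have hcard : Real.log (Fintype.card (FileSpace L)) = L * Real.log 2 := by
    simp [ZMod.card]
  rw [hcard] at key
  have hnn := fun i S => entropyGiven_nonneg
    (fun w : FileIdx G r → FileSpace L => f i (T.Q θ i ω) (fun j => w j.1)) S
  rw [← ENNReal.ofReal_add (div_nonneg (hnn _ _) hlog.le) (div_nonneg (hnn _ _) hlog.le),
    ← ENNReal.ofReal_add (div_nonneg (hnn _ _) hlog.le) (div_nonneg (hnn _ _) hlog.le),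
    ← ENNReal.ofReal_natCast, ← ENNReal.ofReal_ofNat 2, ← ENNReal.ofReal_inv_of_pos two_pos,
    ← ENNReal.ofReal_mul (by norm_num), ← ENNReal.ofReal_add (Nat.cast_nonneg _)]
  · refine ENNReal.ofReal_le_ofReal ?_
    rw [← add_div, ← add_div, le_div_iff₀ hlog]
    refine le_trans (le_of_eq ?_) key
    field_simp
  · have := hnn a (insert θ S)
    have := hnn b (insert θ S)
    positivity

end PIRScheme

/-! ### The converse bound, on an edge and on the path. -/

namespace PIRScheme

variable {V : Type} {G : SimpleGraph V} {r L : ℕ}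

/-- The two endpoints of an edge together download at least `L (1 + 1/2 + ⋯ + 1/2^(r-1))` bits. -/
theorem le_entropy_add_entropy [Finite V] (T : PIRScheme G r L) {e : G.edgeSet} {a b : V}
    (he : (e : Sym2 V) = s(a, b)) (θ₀ : FileIdx G r) :
    ENNReal.ofReal (L * (2 - 2 * (1 / 2) ^ r)) ≤
      entropy T.P (T.A θ₀ a) + entropy T.P (T.A θ₀ b) := by
  classical
  have : Fintype (FileIdx G r) := Fintype.ofFinite _
  choose f hf using fun i => T.exists_answer_function θ₀ i
  let S : ℕ → Set (FileIdx G r) := fun k => {j | j.1 ≠ e ∨ (j.2 : ℕ) < k}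
  -- The constant c_k = 2 - 2·2^(-k) solves c_(k+1) = 1 + c_k/2 with c_0 = 0. Going from `k` to `k +
  -- 1` removes one file of the edge from the conditioning; at `k = r` only the files off the edge
  -- remain.
  have key : ∀ k ≤ r, ENNReal.ofReal (L * (2 - 2 * (1 / 2) ^ k)) ≤
      T.answerEntropyGiven f θ₀ a (S (r - k)) + T.answerEntropyGiven f θ₀ b (S (r - k)) := by
    intro k
    induction k with
    | zero => simp
    | succ k ih =>
      intro hk
      let θ : FileIdx G r := (e, ⟨r - (k + 1), by omega⟩)
      have hθ : θ ∉ S (r - (k + 1)) := by simp [S, θ]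
      have hins : insert θ (S (r - (k + 1))) = S (r - k) := by
        ext ⟨e', j⟩
        simp only [S, θ, Set.mem_insert_iff, Set.mem_ofPred_eq, Prod.mk.injEq, Fin.ext_iff]
        by_cases h : e' = e <;> simp [h]
        omega
      have hstep := T.answerEntropyGiven_insert_le hf (a := a) (b := b) hθ fun i ha hb j hj => by
        refine Or.inl fun hje => ?_
        rw [Stores, hje, he, Sym2.mem_iff] at hj
        tauto
      rw [hins] at hstep
      -- Privacy: the desired file is replaced by the one to be decoded at this step.
      rw [T.answerEntropyGiven_eq f θ₀ θ a, T.answerEntropyGiven_eq f θ₀ θ b]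
      refine le_trans ?_ hstep
      have hih := ih (by omega)
      rw [T.answerEntropyGiven_eq f θ₀ θ a, T.answerEntropyGiven_eq f θ₀ θ b] at hih
      refine le_trans ?_ (add_le_add_right (ENNReal.div_le_div_right hih 2) _)
      have hpow : ((1 : ℝ) / 2) ^ k ≤ 1 := pow_le_one₀ (by norm_num) (by norm_num)
      rw [← ENNReal.ofReal_natCast, ← ENNReal.ofReal_ofNat 2, ← ENNReal.ofReal_div_of_pos two_pos,
        ← ENNReal.ofReal_add (Nat.cast_nonneg _)
          (div_nonneg (mul_nonneg (Nat.cast_nonneg _) (by linarith)) two_pos.le)]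
      refine ENNReal.ofReal_le_ofReal (le_of_eq ?_)
      ring
  refine (key r le_rfl).trans ?_
  exact add_le_add (T.answerEntropyGiven_le (fun i θ => hf i θ) θ₀ a _)
    (T.answerEntropyGiven_le (fun i θ => hf i θ) θ₀ b _)

end PIRScheme

lemma two_sub_two_mul_pow_pos {r : ℕ} (hr : 1 ≤ r) : (0 : ℝ) < 2 - 2 * (1 / 2) ^ r := by
  have : ((1 : ℝ) / 2) ^ r ≤ (1 / 2) ^ 1 :=
    pow_le_pow_of_le_one (by norm_num) (by norm_num) hr
  linarith

/-- `finProdFinEquiv` sends `(k, j)` to `2k + j`, so the pairs `(k, 0)`, `(k, 1)` run through the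
perfect matching {2k, 2k+1} of the path. -/
theorem rate_pathGraph_le {m r L : ℕ} (hm : 0 < m) (hr : 1 ≤ r) (hL : 0 < L)
    (T : PIRScheme (SimpleGraph.pathGraph (m * 2)) r L) :
    T.rate ≤ ENNReal.ofReal (1 / (m * (2 - 2 * (1 / 2) ^ r))) := by
  have hc := two_sub_two_mul_pow_pos hr
  have hadj : ∀ k : Fin m, s(finProdFinEquiv (k, (0 : Fin 2)), finProdFinEquiv (k, (1 : Fin 2))) ∈
      (SimpleGraph.pathGraph (m * 2)).edgeSet := by
    intro k
    rw [SimpleGraph.mem_edgeSet, SimpleGraph.pathGraph_adj]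
    simp [finProdFinEquiv]
    omega
  let θ₀ : FileIdx (SimpleGraph.pathGraph (m * 2)) r := (⟨_, hadj ⟨0, hm⟩⟩, ⟨0, hr⟩)
  have hd : ENNReal.ofReal (m * (L * (2 - 2 * (1 / 2) ^ r))) ≤ T.download := by
    refine le_trans ?_ (le_iSup _ θ₀)
    rw [← finProdFinEquiv.sum_comp, Fintype.sum_prod_type]
    simp_rw [Fin.sum_univ_two]
    refine le_trans ?_ (Finset.sum_le_sum fun k _ =>
      T.le_entropy_add_entropy (e := ⟨_, hadj k⟩) rfl θ₀)
    rw [Finset.sum_const, Finset.card_univ, Fintype.card_fin, nsmul_eq_mul,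
      ENNReal.ofReal_mul (Nat.cast_nonneg _), ENNReal.ofReal_natCast]
  refine (ENNReal.div_le_div_left hd _).trans ?_
  have hm' : (0 : ℝ) < m := Nat.cast_pos.2 hm
  have hL' : (0 : ℝ) < L := Nat.cast_pos.2 hL
  rw [← ENNReal.ofReal_natCast, ← ENNReal.ofReal_div_of_pos (by positivity)]
  refine ENNReal.ofReal_le_ofReal (le_of_eq ?_)
  field_simp

/-! ### Uniform measures on finite products. -/

section Uniform

variable {X Y : Type*} [Finite X] [MeasurableSpace X] [MeasurableSingletonClass X]
  [Finite Y] [MeasurableSpace Y] [MeasurableSingletonClass Y]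

lemma uniformOn_univ_prod :
    (uniformOn Set.univ : Measure X).prod (uniformOn Set.univ : Measure Y) =
      uniformOn Set.univ := by
  have := Fintype.ofFinite X
  have := Fintype.ofFinite Y
  refine Measure.ext_of_singleton fun x => ?_
  rw [← Set.singleton_prod_singleton, Measure.prod_prod]
  simp only [uniformOn_univ, Measure.count_singleton, Set.singleton_prod_singleton,
    Fintype.card_prod, Nat.cast_mul, ENNReal.div_eq_inv_mul, mul_one]
  rw [ENNReal.mul_inv (Or.inr (by simp)) (Or.inl (by simp))]

lemma measurePreserving_equiv_uniformOn (e : X ≃ X) :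
    MeasurePreserving e (uniformOn Set.univ) (uniformOn Set.univ) := by
  have := Fintype.ofFinite X
  refine ⟨Measurable.of_discrete, Measure.ext_of_singleton fun x => ?_⟩
  rw [Measure.map_apply Measurable.of_discrete (measurableSet_singleton x)]
  have : e ⁻¹' {x} = {e.symm x} := by
    ext y
    simp [Equiv.eq_symm_apply]
  rw [this, uniformOn_univ, uniformOn_univ, Measure.count_singleton, Measure.count_singleton]

lemma map_snd_eval_uniformOn [Nonempty X] [Nonempty Y] {F : Type*} [Finite F] (f : F) :
    ((uniformOn Set.univ : Measure (X × (F → Y))).map fun ω => ω.2 f) = uniformOn Set.univ := by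
  have := Fintype.ofFinite F
  have h : (fun ω : X × (F → Y) => ω.2 f) = Function.eval f ∘ Prod.snd := rfl
  rw [h, ← Measure.map_map (measurable_pi_apply f) measurable_snd, ← uniformOn_univ_prod,
    Measure.map_snd_prod, measure_univ, one_smul, ← Set.pi_univ Set.univ, uniformOn_pi]
  exact (measurePreserving_eval _ f).map_eq

lemma iIndepFun_snd_eval_uniformOn [Nonempty X] [Nonempty Y] {F : Type*} [Finite F] :
    iIndepFun (fun (f : F) (ω : X × (F → Y)) => ω.2 f) (uniformOn Set.univ) := by
  have := Fintype.ofFinite F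
  rw [iIndepFun_iff_map_fun_eq_pi_map fun f => Measurable.of_discrete.aemeasurable]
  simp_rw [map_snd_eval_uniformOn]
  rw [← uniformOn_pi, Set.pi_univ, ← uniformOn_univ_prod]
  exact (Measure.map_snd_prod).trans (by rw [measure_univ, one_smul])

end Uniform

/-! ### Criteria for entropy zero and one. -/

section Entropy

variable {Ω : Type*} [MeasurableSpace Ω] {P : Measure Ω}

lemma entropy_eq_zero_of_eq_zero_or_one {S : Type*} {X : Ω → S}
    (h : ∀ s, P (X ⁻¹' {s}) = 0 ∨ P (X ⁻¹' {s}) = 1) : entropy P X = 0 := by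
  rw [entropy, ENNReal.tsum_eq_zero]
  intro s
  rcases h s with h | h <;> simp [Measure.real, h]

lemma condEntropy_eq_zero_of_factors [IsFiniteMeasure P] {S T : Type*} [MeasurableSpace T]
    [MeasurableSingletonClass T] {X : Ω → S} {Y : Ω → T} (hY : Measurable Y)
    (h : ∀ ω ω', Y ω = Y ω' → X ω = X ω') : condEntropy P X Y = 0 := by
  rw [condEntropy, ENNReal.tsum_eq_zero]
  intro t
  by_cases h0 : P (Y ⁻¹' {t}) = 0
  · rw [h0, zero_mul]
  rw [entropy_eq_zero_of_eq_zero_or_one, mul_zero]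
  intro s
  rw [cond_apply (hY (measurableSet_singleton t))]
  by_cases hs : ∃ ω, Y ω = t ∧ X ω = s
  · obtain ⟨ω, hω, hs⟩ := hs
    right
    have hsub : Y ⁻¹' {t} ⊆ X ⁻¹' {s} := fun ω' hω' => (h ω' ω (Eq.trans hω' hω.symm)).trans hs
    rw [Set.inter_eq_left.2 hsub,
      ENNReal.inv_mul_cancel h0 (measure_ne_top _ _)]
  · left
    have : Y ⁻¹' {t} ∩ X ⁻¹' {s} = ∅ :=
      Set.eq_empty_of_forall_notMem fun ω hω => hs ⟨ω, hω.1, hω.2⟩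
    rw [this, measure_empty, mul_zero]

lemma entropy_zmod_two_eq_one [IsProbabilityMeasure P] {X : Ω → ZMod 2} (hX : Measurable X)
    (h : P (X ⁻¹' {0}) = P (X ⁻¹' {1})) : entropy P X = 1 := by
  have hu : X ⁻¹' {0} ∪ X ⁻¹' {1} = Set.univ := by
    rw [← Set.preimage_union]
    refine Set.eq_univ_of_forall fun ω => ?_
    have : ∀ x : ZMod 2, x ∈ ({0} ∪ {1} : Set (ZMod 2)) := by
      intro x
      fin_cases x
      · exact Or.inl rfl
      · exact Or.inr rfl
    exact this _
  have hd : Disjoint (X ⁻¹' {0}) (X ⁻¹' {1}) := Disjoint.preimage _ (by simp)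
  have h1 := measureReal_union (μ := P) hd (hX (measurableSet_singleton 1))
  have h2 : P.real (X ⁻¹' {0}) = P.real (X ⁻¹' {1}) := by rw [Measure.real, h, Measure.real]
  rw [hu, probReal_univ] at h1
  have h3 : P.real (X ⁻¹' {1}) = 1 / 2 := by linarith
  have hlog : 0 < Real.log 2 := Real.log_pos one_lt_two
  have h4 : Real.negMulLog (1 / 2) / Real.log 2 = 1 / 2 := by
    rw [Real.negMulLog, one_div, Real.log_inv]
    field_simp
  rw [entropy, tsum_fintype]
  change ∑ s : Fin 2, _ = _
  rw [Fin.sum_univ_two]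
  change ENNReal.ofReal (Real.negMulLog (P.real (X ⁻¹' {0})) / _) +
    ENNReal.ofReal (Real.negMulLog (P.real (X ⁻¹' {1})) / _) = 1
  rw [h2, h3, h4, ← ENNReal.ofReal_add (by norm_num) (by norm_num)]
  norm_num

/-- A bit that can be flipped by a measure preserving map without changing `Y` is uniform given
`Y`. -/
lemma condEntropy_zmod_two_eq_one [IsProbabilityMeasure P] {T : Type*} [Countable T]
    [MeasurableSpace T] [MeasurableSingletonClass T] {X : Ω → ZMod 2} {Y : Ω → T}
    (hX : Measurable X) (hY : Measurable Y) {Φ : Ω → Ω} (hΦ : MeasurePreserving Φ P P)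
    (hXΦ : ∀ ω, X (Φ ω) = X ω + 1) (hYΦ : ∀ ω, Y (Φ ω) = Y ω) : condEntropy P X Y = 1 := by
  have hterm : ∀ t, P (Y ⁻¹' {t}) * entropy (ProbabilityTheory.cond P (Y ⁻¹' {t})) X =
      P (Y ⁻¹' {t}) := by
    intro t
    by_cases h0 : P (Y ⁻¹' {t}) = 0
    · rw [h0, zero_mul]
    have := cond_isProbabilityMeasure h0
    have hmt := hY (measurableSet_singleton t)
    rw [entropy_zmod_two_eq_one hX, mul_one]
    rw [cond_apply hmt, cond_apply hmt,
      ← hΦ.measure_preimage (hmt.inter (hX (measurableSet_singleton 1))).nullMeasurableSet]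
    congr 2
    ext ω
    simp [hXΦ, hYΦ]
  rw [condEntropy, tsum_congr hterm]
  have := measure_iUnion (μ := P) (f := fun t => Y ⁻¹' {t})
    (fun t t' h => Disjoint.preimage _ (by simpa using h)) fun t => hY (measurableSet_singleton t)
  rw [← this, ← Set.preimage_iUnion, Set.iUnion_of_singleton, Set.preimage_univ, measure_univ]

end Entropy

/-! ### The scheme built from edge cuts. -/

section CutScheme

variable {V : Type} [Fintype V] {G : SimpleGraph V} {r L : ℕ}
variable {K M : Type}

open Classical in
/-- The answer of server `i` to the query `q`: the sum over its incident edges of a function of the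
query and the files on the edge. -/
def edgeSum [AddCommMonoid M] (φ : K → (Fin r → FileSpace L) → M) (i : V) (q : K)
    (w : FileIdx G r → FileSpace L) : M :=
  ∑ e : G.edgeSet, if i ∈ (e : Sym2 V) then φ q (fun j => w (e, j)) else 0

open Classical in
/-- The query of server `i`: the key on one side of the cut given by the edge of the desired file,
and the shifted key on the other side. -/
def cutQuery (side : G.edgeSet → V → Prop) (σ : Fin r → Equiv.Perm K) (θ : FileIdx G r) (i : V) :
    Equiv.Perm K :=
  if side θ.1 i then Equiv.refl K else σ θ.2

open Classical in
lemma sum_filter_mem_sym2 [AddCommMonoid M] (p : V → Prop) {a b : V} (hab : a ≠ b) (x : M) :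
    (∑ i with p i, if i ∈ s(a, b) then x else 0) =
      (if p a then x else 0) + if p b then x else 0 := by
  have h : ∀ i, (if p i then (if i ∈ s(a, b) then x else 0) else 0) =
      (if i = a then (if p a then x else 0) else 0) +
        if i = b then (if p b then x else 0) else 0 := by
    intro i
    by_cases ha : i = a
    · subst ha
      simp [hab]
    · by_cases hb : i = b
      · subst hb
        simp [hab.symm]
      · simp [ha, hb]
  rw [Finset.sum_filter, Finset.sum_congr rfl fun i _ => h i, Finset.sum_add_distrib,
    Finset.sum_ite_eq', Finset.sum_ite_eq']
  simp

-- `hp` says that `e` is the only edge crossing between `p` and its complement. Any other edge is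
-- counted by both endpoints or by neither and cancels by `hM`; `e` is counted once.
open Classical in
lemma sum_edgeSum_side [AddCommMonoid M] (hM : ∀ m : M, m + m = 0)
    (φ : K → (Fin r → FileSpace L) → M) {p : V → Prop} {e : G.edgeSet}
    (hp : ∀ (e' : G.edgeSet) (a b : V), (e' : Sym2 V) = s(a, b) → ((p a ↔ p b) ↔ e' ≠ e))
    (q : K) (w : FileIdx G r → FileSpace L) :
    ∑ i with p i, edgeSum φ i q w = φ q (fun j => w (e, j)) := by
  unfold edgeSum
  have hends : ∀ e' : G.edgeSet, ∃ a b, a ≠ b ∧ (e' : Sym2 V) = s(a, b) := by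
    rintro ⟨e', he'⟩
    induction e' with | _ a b =>
    exact ⟨a, b, (G.mem_edgeSet.1 he').ne, rfl⟩
  rw [Finset.sum_comm, Finset.sum_eq_single e]
  · obtain ⟨a, b, hab, he⟩ := hends e
    have h := hp e a b he
    rw [he, sum_filter_mem_sym2 p hab]
    by_cases ha : p a <;> by_cases hb : p b <;> simp_all
  · intro e' _ hne
    obtain ⟨a, b, hab, he⟩ := hends e'
    have h := hp e' a b he
    rw [he, sum_filter_mem_sym2 p hab]
    by_cases ha : p a <;> by_cases hb : p b <;> simp_all
  · simp

lemma edgeSum_add_single [AddCommMonoid M] [DecidableEq (FileIdx G r)]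
    (φ : K → (Fin r → FileSpace L) → M) (hφ : ∀ q w w', φ q (w + w') = φ q w + φ q w')
    {i : V} {θ : FileIdx G r} (hi : Stores i θ) (q : K) (w : FileIdx G r → FileSpace L)
    (x : FileSpace L) :
    edgeSum φ i q (w + Pi.single θ x) = edgeSum φ i q w + φ q (Pi.single θ.2 x) := by
  classical
  obtain ⟨e, j⟩ := θ
  unfold edgeSum
  rw [← Finset.sum_erase_add _ _ (Finset.mem_univ e), ← Finset.sum_erase_add _ _ (Finset.mem_univ e),
    if_pos (show i ∈ (e : Sym2 V) from hi), if_pos (show i ∈ (e : Sym2 V) from hi), add_assoc, ← hφ]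
  congr 1
  · refine Finset.sum_congr rfl fun e' he' => ?_
    have hne := Finset.ne_of_mem_erase he'
    congr 2
    funext j'
    simp [hne]
  · congr 1
    funext j'
    simp only [Pi.add_apply, Pi.single_apply, Prod.mk.injEq, true_and]

variable [Finite K] [MeasurableSpace K] [MeasurableSingletonClass K]

/-- For fixed `θ` and `i` the query is a bijective image of the key, so each server sees a uniform
query independent of the files: this is why the scheme is private. -/
lemma measurePreserving_cutQuery (side : G.edgeSet → V → Prop) (σ : Fin r → Equiv.Perm K)
    (θ : FileIdx G r) (i : V) :
    MeasurePreserving (fun ω : K × (FileIdx G r → FileSpace L) => (cutQuery side σ θ i ω.1, ω.2))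
      (uniformOn Set.univ) (uniformOn Set.univ) :=
  measurePreserving_equiv_uniformOn ((cutQuery side σ θ i).prodCongr (Equiv.refl _))

variable [Nonempty K] [AddCommMonoid M] [Finite M] [MeasurableSpace M] [MeasurableSingletonClass M]

/-- The scheme in which the servers on one side of the desired edge receive a uniform key, and those
on the other side receive a shifted key. -/
def cutScheme (side : G.edgeSet → V → Prop)
    (hside : ∀ (e e' : G.edgeSet) (a b : V), (e' : Sym2 V) = s(a, b) →
      ((side e a ↔ side e b) ↔ e' ≠ e))
    (σ : Fin r → Equiv.Perm K) (φ : K → (Fin r → FileSpace L) → M) (hM : ∀ m : M, m + m = 0)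
    (hdec : ∀ k j w w', φ k w = φ k w' → φ (σ j k) w = φ (σ j k) w' → w j = w' j) :
    PIRScheme G r L where
  Ω := K × (FileIdx G r → FileSpace L)
  P := uniformOn Set.univ
  Query _ := K
  Answer _ := M
  W f ω := ω.2 f
  Q θ i ω := cutQuery side σ θ i ω.1
  A θ i ω := edgeSum φ i (cutQuery side σ θ i ω.1) ω.2
  measurable_W _ := Measurable.of_discrete
  measurable_Q _ _ := Measurable.of_discrete
  measurable_A _ _ := Measurable.of_discrete
  uniform_W f := map_snd_eval_uniformOn f
  indep_W := iIndepFun_snd_eval_uniformOn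
  indep_W_Q θ := by
    have h : IndepFun (fun ω : K × (FileIdx G r → FileSpace L) => ω.2) Prod.fst
        (uniformOn Set.univ) := by
      rw [← uniformOn_univ_prod]
      exact (indepFun_prod (X := id) (Y := id) measurable_id measurable_id).symm
    exact h.comp measurable_id (Measurable.of_discrete (f := fun k i => cutQuery side σ θ i k))
  answer_determined θ i := by
    refine condEntropy_eq_zero_of_factors Measurable.of_discrete fun ω ω' h => ?_
    rw [Prod.mk.injEq] at h
    rw [h.1]
    unfold edgeSum
    refine Finset.sum_congr rfl fun e _ => ?_
    split_ifs with hi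
    · congr 1
      funext j
      exact congrFun h.2 ⟨(e, j), hi⟩
    · rfl
  reliable θ := by
    classical
    refine condEntropy_eq_zero_of_factors Measurable.of_discrete
      fun (ω ω' : K × (FileIdx G r → FileSpace L)) h => ?_
    rw [Prod.mk.injEq] at h
    obtain ⟨hA, hQ⟩ := h
    -- A server on the unshifted side exists because the cut edge has an endpoint there; its query
    -- is the key itself.
    obtain ⟨a, ha⟩ : ∃ a, side θ.1 a := by
      obtain ⟨⟨e, he⟩, j⟩ := θ
      induction e with | _ a b =>
      by_contra! hno
      have := hside ⟨_, he⟩ ⟨_, he⟩ a b rfl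
      simp only [hno, ne_eq, not_true_eq_false, iff_false] at this
    have hkey : ω.1 = ω'.1 := by
      have := congrFun hQ a
      simpa [cutQuery, ha] using this
    -- Stated for a general `p` so as to apply both to the side and to its complement.
    have hsum : ∀ (p : V → Prop) (k : Equiv.Perm K), (∀ i, p i → cutQuery side σ θ i = k) →
        (∀ (e' : G.edgeSet) (a b : V), (e' : Sym2 V) = s(a, b) → ((p a ↔ p b) ↔ e' ≠ θ.1)) →
        φ (k ω.1) (fun j => ω.2 (θ.1, j)) = φ (k ω.1) (fun j => ω'.2 (θ.1, j)) := by
      intro p k hk hp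
      rw [← sum_edgeSum_side hM φ hp, ← sum_edgeSum_side hM φ hp]
      refine Finset.sum_congr rfl fun i hi => ?_
      have h := congrFun hA i
      simp only [hk i (Finset.mem_filter.1 hi).2, ← hkey] at h
      exact h
    exact hdec ω.1 θ.2 _ _
      (hsum (side θ.1) (Equiv.refl K) (fun i hi => by simp [cutQuery, hi]) (hside θ.1))
      (hsum (fun i => ¬ side θ.1 i) (σ θ.2) (fun i hi => by simp [cutQuery, hi])
        fun e' a b he => not_iff_not.trans (hside θ.1 e' a b he))
  isPrivate θ θ' i := by
    have h : ∀ θ, IdentDistrib (fun ω : K × (FileIdx G r → FileSpace L) =>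
        (cutQuery side σ θ i ω.1, edgeSum φ i (cutQuery side σ θ i ω.1) ω.2,
          fun f : {f // Stores i f} => ω.2 f.1))
        (fun ω : K × (FileIdx G r → FileSpace L) => (ω.1, edgeSum φ i ω.1 ω.2, fun f : {f // Stores i f} => ω.2 f.1))
        (uniformOn Set.univ) (uniformOn Set.univ) := fun θ =>
      ⟨Measurable.of_discrete.aemeasurable, Measurable.of_discrete.aemeasurable, by
        conv_rhs => rw [← (measurePreserving_cutQuery (L := L) side σ θ i).map_eq]
        rw [Measure.map_map Measurable.of_discrete Measurable.of_discrete]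
        rfl⟩
    exact (h θ).trans (h θ').symm

lemma entropy_cutScheme_answer {side : G.edgeSet → V → Prop}
    (hside : ∀ (e e' : G.edgeSet) (a b : V), (e' : Sym2 V) = s(a, b) →
      ((side e a ↔ side e b) ↔ e' ≠ e))
    {σ : Fin r → Equiv.Perm K} {φ : K → (Fin r → FileSpace L) → M} (hM : ∀ m : M, m + m = 0)
    (hdec : ∀ k j w w', φ k w = φ k w' → φ (σ j k) w = φ (σ j k) w' → w j = w' j)
    (θ : FileIdx G r) (i : V) :
    entropy (cutScheme side hside σ φ hM hdec).P ((cutScheme side hside σ φ hM hdec).A θ i) =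
      entropy (uniformOn Set.univ : Measure (K × (FileIdx G r → FileSpace L)))
        (fun ω => edgeSum φ i ω.1 ω.2) := by
  have hX : Measurable fun ω : K × (FileIdx G r → FileSpace L) => edgeSum φ i ω.1 ω.2 :=
    Measurable.of_discrete
  have hΨ := measurePreserving_cutQuery (L := L) side σ θ i
  have h := entropy_comp_measurePreserving hX hΨ
  exact h

end CutScheme

/-! ### Cuts of the path. -/

section PathCut

variable {N : ℕ}

/-- The side of the cut of the path given by the edge `e`. -/
def pathSide (e : (SimpleGraph.pathGraph N).edgeSet) (i : Fin N) : Prop :=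
  i ≤ (e : Sym2 (Fin N)).inf

/-- The side is the initial segment ending at the smaller endpoint of `e`, and `e` is the only path
edge leaving it. -/
lemma pathSide_iff (e e' : (SimpleGraph.pathGraph N).edgeSet) (a b : Fin N)
    (h : (e' : Sym2 (Fin N)) = s(a, b)) :
    (pathSide e a ↔ pathSide e b) ↔ e' ≠ e := by
  obtain ⟨e, he⟩ := e
  obtain ⟨e', he'⟩ := e'
  induction e with | _ c d =>
  simp only at h
  subst h
  rw [SimpleGraph.mem_edgeSet, SimpleGraph.pathGraph_adj] at he he'
  simp only [pathSide, Sym2.inf_mk, Ne, Subtype.mk.injEq, Sym2.eq_iff, le_inf_iff, Fin.le_def,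
    Fin.ext_iff]
  omega

lemma exists_stores (hN : 2 ≤ N) {r : ℕ} (hr : 1 ≤ r) (i : Fin N) :
    ∃ θ : FileIdx (SimpleGraph.pathGraph N) r, Stores i θ := by
  obtain ⟨j, hj⟩ : ∃ j, (SimpleGraph.pathGraph N).Adj i j := by
    simp only [SimpleGraph.pathGraph_adj]
    by_cases h : i.val + 1 < N
    · exact ⟨⟨i.val + 1, h⟩, Or.inl rfl⟩
    · exact ⟨⟨i.val - 1, by omega⟩, Or.inr (by simp only; omega)⟩
  exact ⟨(⟨s(i, j), hj⟩, ⟨0, hr⟩), Sym2.mem_mk_left i j⟩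

end PathCut

/-! ### Random linear combinations and their entropy. -/

section LinearQueries

variable {V : Type} [Fintype V] {G : SimpleGraph V} {r L : ℕ}

/-- The linear combination of the files on an edge with coefficient vector `q`. -/
def linearAnswer (q : Fin r → ZMod 2) (w : Fin r → FileSpace L) : FileSpace L :=
  ∑ j, q j • w j

lemma linearAnswer_add (q : Fin r → ZMod 2) (w w' : Fin r → FileSpace L) :
    linearAnswer q (w + w') = linearAnswer q w + linearAnswer q w' := by
  simp [linearAnswer, smul_add, Finset.sum_add_distrib]

lemma linearAnswer_single (q : Fin r → ZMod 2) (j : Fin r) (x : FileSpace L) :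
    linearAnswer q (Pi.single j x) = q j • x := by
  rw [linearAnswer, Finset.sum_eq_single j]
  · simp
  · intro j' _ hne
    simp [hne]
  · simp

lemma linearAnswer_decode (k : Fin r → ZMod 2) (j : Fin r) (w w' : Fin r → FileSpace L)
    (h : linearAnswer k w = linearAnswer k w')
    (h' : linearAnswer (Equiv.addRight (Pi.single j 1) k) w =
      linearAnswer (Equiv.addRight (Pi.single j 1) k) w') : w j = w' j := by
  have key : ∀ w : Fin r → FileSpace L, linearAnswer (Equiv.addRight (Pi.single j 1) k) w =
      linearAnswer k w + w j := by
    intro w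
    simp [linearAnswer, add_smul, Finset.sum_add_distrib, Pi.single_apply]
  rw [key, key, h] at h'
  exact add_left_cancel h'

lemma fileSpace_add_self (x : FileSpace L) : x + x = 0 :=
  funext fun _ => CharTwo.add_self_eq_zero _

lemma edgeSum_linearAnswer_zero (i : V) (w : FileIdx G r → FileSpace L) :
    edgeSum linearAnswer i 0 w = 0 := by
  simp [edgeSum, linearAnswer]

lemma uniformOn_fst_ne_zero {Y : Type*} [Finite Y] [Nonempty Y] [MeasurableSpace Y]
    [MeasurableSingletonClass Y] :
    (uniformOn Set.univ : Measure ((Fin r → ZMod 2) × Y)).real {ω | ω.1 ≠ 0} =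
      1 - (1 / 2) ^ r := by
  have h : {ω : (Fin r → ZMod 2) × Y | ω.1 ≠ 0} = ({0} ×ˢ Set.univ)ᶜ := by
    ext
    simp
  rw [h, probReal_compl_eq_one_sub MeasurableSet.of_discrete, ← uniformOn_univ_prod,
    measureReal_prod_prod, probReal_univ, Measure.real, uniformOn_univ, Measure.count_singleton]
  simp

/-- For a nonzero query `q` with `q j = 1`, adding `a` to the file `(θ.1, j)` preserves the measure
and shifts the answer by `a`. Hence all 2^L values share equally the mass 1 - 2^(-r) of the nonzero
queries. -/
lemma linearAnswer_measure_eq (hr : 1 ≤ r) {i : V} {θ : FileIdx G r} (hi : Stores i θ)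
    (a : FileSpace L) :
    (uniformOn Set.univ : Measure ((Fin r → ZMod 2) × (FileIdx G r → FileSpace L))).real
      {ω | edgeSum linearAnswer i ω.1 ω.2 = a ∧ ω.1 ≠ 0} = (1 - (1 / 2) ^ r) / 2 ^ L := by
  classical
  set P := (uniformOn Set.univ : Measure ((Fin r → ZMod 2) × (FileIdx G r → FileSpace L)))
  let E : FileSpace L → Set ((Fin r → ZMod 2) × (FileIdx G r → FileSpace L)) :=
    fun a => {ω | edgeSum linearAnswer i ω.1 ω.2 = a ∧ ω.1 ≠ 0}
  -- The implication sits inside the existential so that `choose` yields a total function; its value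
  -- at `q = 0` is irrelevant.
  have hcoord : ∀ q : Fin r → ZMod 2, ∃ j, q ≠ 0 → q j = 1 := by
    intro q
    by_cases hq : q = 0
    · exact ⟨⟨0, hr⟩, fun h => absurd hq h⟩
    · obtain ⟨j, hj⟩ := Function.ne_iff.1 hq
      exact ⟨j, fun _ => (Fin.eq_one_of_ne_zero _ hj)⟩
  choose j hj using hcoord
  have hE : ∀ a, P.real (E a) = P.real (E 0) := by
    intro a
    have hΦ := measurePreserving_equiv_uniformOn
      (Equiv.prodShear (Equiv.refl (Fin r → ZMod 2)) fun q =>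
        Equiv.addRight (Pi.single (θ.1, j q) a : FileIdx G r → FileSpace L))
    rw [Measure.real, Measure.real, ← hΦ.measure_preimage MeasurableSet.of_discrete.nullMeasurableSet]
    congr 2
    ext ω
    simp only [E, Set.mem_preimage, Set.mem_ofPred_eq, Equiv.prodShear_apply, Equiv.refl_apply,
      Equiv.coe_addRight]
    refine and_congr_left fun hq => ?_
    rw [edgeSum_add_single _ linearAnswer_add (θ := (θ.1, j ω.1)) hi, linearAnswer_single, hj _ hq,
      one_smul]
    simp
  have hsum : ∑ a, P.real (E a) = 1 - (1 / 2) ^ r := by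
    have h := sum_measureReal_preimage_singleton (μ := P.restrict {ω | ω.1 ≠ 0})
      (Finset.univ : Finset (FileSpace L))
      (f := fun ω : (Fin r → ZMod 2) × (FileIdx G r → FileSpace L) =>
        edgeSum linearAnswer i ω.1 ω.2) fun _ _ => MeasurableSet.of_discrete
    simp_rw [measureReal_restrict_apply MeasurableSet.of_discrete] at h
    rw [Finset.coe_univ, Set.preimage_univ, Set.univ_inter] at h
    exact h.trans uniformOn_fst_ne_zero
  change P.real (E a) = _
  simp_rw [hE] at hsum
  rw [Finset.sum_const, Finset.card_univ, nsmul_eq_mul] at hsum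
  rw [hE, ← hsum]
  simp [ZMod.card]

lemma entropy_linearAnswer_le (hr : 1 ≤ r) {i : V} {θ : FileIdx G r} (hi : Stores i θ) :
    entropy (uniformOn Set.univ : Measure ((Fin r → ZMod 2) × (FileIdx G r → FileSpace L)))
      (fun ω => edgeSum linearAnswer i ω.1 ω.2) ≤
      ENNReal.ofReal ((1 - (1 / 2) ^ r) * L + 4) := by
  classical
  set P := (uniformOn Set.univ : Measure ((Fin r → ZMod 2) × (FileIdx G r → FileSpace L)))
  set c : ℝ := 1 - (1 / 2) ^ r with hc
  have hc0 : 0 < c := by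
    have := two_sub_two_mul_pow_pos hr
    linarith
  have hc1 : c ≤ 1 := by
    have : (0 : ℝ) ≤ (1 / 2) ^ r := by positivity
    linarith
  have hlog : 1 / 2 < Real.log 2 := by linarith [Real.log_two_gt_d9]
  have hlog0 : 0 < Real.log 2 := by linarith
  -- The 4 in the bound is 2 + 2: one 2 for the value `0`, which also receives the mass of the zero
  -- query, and one for the term -c log₂ c. Both follow from -x log x ≤ 1 and log 2 > 1/2.
  have hdiv : ∀ x : ℝ, 0 ≤ x → Real.negMulLog x / Real.log 2 ≤ 2 := by
    intro x hx
    rw [div_le_iff₀ hlog0]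
    linarith [Real.negMulLog_le_one_sub_self hx]
  have hterm : ∀ a : FileSpace L, ENNReal.ofReal (Real.negMulLog (P.real
      ((fun ω => edgeSum linearAnswer i ω.1 ω.2) ⁻¹' {a})) / Real.log 2) ≤
      (if a = 0 then ENNReal.ofReal 2 else 0) +
        ENNReal.ofReal (Real.negMulLog (c / 2 ^ L) / Real.log 2) := by
    intro a
    by_cases ha : a = 0
    · rw [if_pos ha]
      exact le_add_right (ENNReal.ofReal_le_ofReal (hdiv _ measureReal_nonneg))
    · rw [if_neg ha, zero_add, ← linearAnswer_measure_eq hr hi a]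
      refine le_of_eq ?_
      congr 4
      ext ω
      simp only [Set.mem_preimage, Set.mem_singleton_iff, Set.mem_ofPred_eq, iff_self_and]
      intro h h0
      rw [h0, edgeSum_linearAnswer_zero] at h
      exact ha h.symm
  rw [entropy, tsum_fintype]
  refine (Finset.sum_le_sum fun a _ => hterm a).trans ?_
  have hpow : (0 : ℝ) < 2 ^ L := by positivity
  have hcard : (Fintype.card (FileSpace L) : ℝ) = 2 ^ L := by simp [ZMod.card]
  rw [Finset.sum_add_distrib, Finset.sum_ite_eq', if_pos (Finset.mem_univ _), Finset.sum_const,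
    Finset.card_univ, nsmul_eq_mul, ← ENNReal.ofReal_natCast, ← ENNReal.ofReal_mul (by positivity),
    hcard]
  have h0 : 0 ≤ Real.negMulLog (c / 2 ^ L) / Real.log 2 := by
    refine div_nonneg (Real.negMulLog_nonneg (by positivity) ?_) hlog0.le
    rw [div_le_one hpow]
    exact hc1.trans (one_le_pow₀ one_le_two)
  rw [← ENNReal.ofReal_add (by norm_num) (by positivity)]
  refine ENNReal.ofReal_le_ofReal ?_
  have h1 : 2 ^ L * (Real.negMulLog (c / 2 ^ L) / Real.log 2) =
      c * L + Real.negMulLog c / Real.log 2 := by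
    rw [Real.negMulLog, Real.negMulLog, Real.log_div hc0.ne' hpow.ne', Real.log_pow]
    field_simp
    ring
  rw [h1]
  linarith [hdiv c hc0.le]

end LinearQueries

/-- The scheme on the path in which every server sends a random linear combination of its files. -/
def linearScheme (N r L : ℕ) : PIRScheme (SimpleGraph.pathGraph N) r L :=
  cutScheme pathSide pathSide_iff (fun j => Equiv.addRight (Pi.single j (1 : ZMod 2)))
    linearAnswer fileSpace_add_self linearAnswer_decode

lemma linearScheme_download_le {N r : ℕ} (hN : 2 ≤ N) (hr : 1 ≤ r) (L : ℕ) :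
    (linearScheme N r L).download ≤ ENNReal.ofReal (N * ((1 - (1 / 2) ^ r) * L + 4)) := by
  refine iSup_le fun θ => (Finset.sum_le_sum
    (g := fun _ => ENNReal.ofReal ((1 - (1 / 2) ^ r) * L + 4)) fun i _ => ?_).trans (le_of_eq ?_)
  · obtain ⟨f, hf⟩ := exists_stores hN hr i
    rw [linearScheme, entropy_cutScheme_answer]
    exact entropy_linearAnswer_le hr hf
  · rw [Finset.sum_const, Finset.card_univ, Fintype.card_fin, nsmul_eq_mul,
      ENNReal.ofReal_mul (Nat.cast_nonneg _), ENNReal.ofReal_natCast]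

/-- The additive constant 4 in each answer's entropy, divided by the file length `n + 1`, vanishes
in the limit. -/
lemma le_capacity_pathGraph {N r : ℕ} (hN : 2 ≤ N) (hr : 1 ≤ r) :
    ENNReal.ofReal (1 / (N * (1 - (1 / 2) ^ r))) ≤ capacity (SimpleGraph.pathGraph N) r := by
  set c : ℝ := 1 - (1 / 2) ^ r with hc
  have hc0 : 0 < c := by
    have := two_sub_two_mul_pow_pos hr
    linarith
  have hN0 : (0 : ℝ) < N := Nat.cast_pos.2 (by omega)
  have hrate : ∀ n : ℕ, ENNReal.ofReal (1 / (N * (c + 4 * (1 / ((n : ℝ) + 1))))) ≤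
      capacity (SimpleGraph.pathGraph N) r := by
    intro n
    refine le_trans ?_ (le_iSup_of_le (n + 1) (le_iSup_of_le n.succ_pos
      (le_iSup PIRScheme.rate (linearScheme N r (n + 1)))))
    have hd := linearScheme_download_le hN hr (n + 1)
    refine le_trans (le_of_eq ?_) (ENNReal.div_le_div_left hd _)
    rw [← ENNReal.ofReal_natCast, ← ENNReal.ofReal_div_of_pos (by positivity)]
    congr 1
    push_cast
    have : (0 : ℝ) < (n : ℝ) + 1 := by positivity
    rw [← hc]
    field_simp
  have hlim : Filter.Tendsto (fun n : ℕ => 1 / (N * (c + 4 * (1 / ((n : ℝ) + 1))))) Filter.atTop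
      (nhds (1 / (N * (c + 4 * 0)))) :=
    tendsto_const_nhds.div
      (((tendsto_one_div_add_atTop_nhds_zero_nat.const_mul 4).const_add c).const_mul (N : ℝ))
      (by rw [mul_zero, add_zero]; positivity)
  rw [mul_zero, add_zero] at hlim
  exact le_of_tendsto' (ENNReal.tendsto_ofReal hlim) hrate

/-! ### The one-bit scheme with symmetric retrieval. -/

section HalfFileScheme

variable {N : ℕ}

/-- The bit with index `q` of the file on an edge. -/
def bitAnswer (q : Fin 2) (w : Fin 1 → FileSpace 2) : ZMod 2 := w 0 q

lemma bitAnswer_decode (k : Fin 2) (j : Fin 1) (w w' : Fin 1 → FileSpace 2)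
    (h : bitAnswer k w = bitAnswer k w')
    (h' : bitAnswer (Equiv.addRight 1 k) w = bitAnswer (Equiv.addRight 1 k) w') : w j = w' j := by
  rw [Subsingleton.elim j 0]
  funext b
  by_cases hb : b = k
  · exact hb ▸ h
  · have hflip : ∀ b k : Fin 2, b ≠ k → b = k + 1 := by decide
    have : b = Equiv.addRight 1 k := hflip b k hb
    exact this ▸ h'

/-- The scheme on the path in which every server sends one bit. -/
def halfFileScheme (N : ℕ) : PIRScheme (SimpleGraph.pathGraph N) 1 2 :=
  cutScheme pathSide pathSide_iff (fun _ => Equiv.addRight (1 : Fin 2)) bitAnswer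
    CharTwo.add_self_eq_zero bitAnswer_decode

/-- With key `q`, `Φ` flips bit `κ q` of the file `f`, exactly the bit of `f` that enters the answer
to the query `κ q`. The key and all other files stay put, so the answer is a fair bit even given
them. -/
lemma exists_flip {i : Fin N} {f : FileIdx (SimpleGraph.pathGraph N) 1} (hf : Stores i f)
    (κ : Equiv.Perm (Fin 2)) :
    ∃ Φ : Fin 2 × (FileIdx (SimpleGraph.pathGraph N) 1 → FileSpace 2) →
        Fin 2 × (FileIdx (SimpleGraph.pathGraph N) 1 → FileSpace 2),
      MeasurePreserving Φ (uniformOn Set.univ) (uniformOn Set.univ) ∧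
      (∀ ω, edgeSum bitAnswer i (κ (Φ ω).1) (Φ ω).2 =
        edgeSum bitAnswer i (κ ω.1) ω.2 + 1) ∧
      (∀ ω, (Φ ω).1 = ω.1) ∧ ∀ ω, ∀ f' ≠ f, (Φ ω).2 f' = ω.2 f' := by
  classical
  refine ⟨_, measurePreserving_equiv_uniformOn (Equiv.prodShear (Equiv.refl (Fin 2)) fun q =>
    Equiv.addRight (Pi.single f (Pi.single (κ q) 1) :
      FileIdx (SimpleGraph.pathGraph N) 1 → FileSpace 2)), fun ω => ?_, fun ω => rfl,
    fun ω f' hf' => ?_⟩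
  · refine (edgeSum_add_single bitAnswer (fun _ _ _ => rfl) hf (κ ω.1) ω.2 _).trans ?_
    rw [Subsingleton.elim f.2 0, bitAnswer, Pi.single_eq_same, Pi.single_eq_same]
  · simp [hf']

lemma halfFileScheme_symmetricRetrieval : (halfFileScheme N).SymmetricRetrieval := by
  intro θ i hi
  obtain ⟨Φ, hΦ, hA, hQ, hW⟩ := exists_flip hi
    (cutQuery pathSide (fun _ => Equiv.addRight 1) θ i)
  rw [Nat.cast_ofNat, ENNReal.div_self two_ne_zero ENNReal.ofNat_ne_top]
  refine condEntropy_zmod_two_eq_one ((halfFileScheme N).measurable_A θ i)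
    (((halfFileScheme N).measurable_Q θ i).prodMk
      (measurable_pi_lambda _ fun f => (halfFileScheme N).measurable_W f.1)) hΦ hA fun ω => ?_
  refine Prod.ext (congrArg
    (cutQuery pathSide (fun _ => Equiv.addRight (1 : Fin 2)) θ i) (hQ ω)) ?_
  funext f
  exact hW ω f.1 f.2.2

lemma halfFileScheme_entropy (hN : 2 ≤ N) (θ : FileIdx (SimpleGraph.pathGraph N) 1) (i : Fin N) :
    entropy (halfFileScheme N).P ((halfFileScheme N).A θ i) = 1 := by
  obtain ⟨f, hf⟩ := exists_stores hN le_rfl i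
  obtain ⟨Φ, hΦ, hA, -, -⟩ := exists_flip hf
    (cutQuery pathSide (fun _ => Equiv.addRight 1) θ i)
  have hm := (halfFileScheme N).measurable_A θ i
  refine entropy_zmod_two_eq_one hm ?_
  refine Eq.trans ?_ (hΦ.measure_preimage (hm (measurableSet_singleton _)).nullMeasurableSet)
  refine congrArg _ (Set.ext fun ω => ?_)
  exact (add_eq_right.symm : _ ↔ edgeSum bitAnswer i
    (cutQuery pathSide (fun _ => Equiv.addRight 1) θ i ω.1) ω.2 + 1 = 1).trans
      (Eq.congr_left (hA ω)).symm

lemma halfFileScheme_rate (hN : 2 ≤ N) :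
    (halfFileScheme N).rate = ENNReal.ofReal (2 / (N : ℝ)) := by
  have : Nonempty (FileIdx (SimpleGraph.pathGraph N) 1) :=
    ⟨(exists_stores hN le_rfl ⟨0, by omega⟩).choose⟩
  unfold PIRScheme.rate PIRScheme.download
  simp_rw [halfFileScheme_entropy hN]
  rw [iSup_const, Finset.sum_const, Finset.card_univ, Fintype.card_fin, nsmul_eq_mul, mul_one,
    ENNReal.ofReal_div_of_pos (Nat.cast_pos.2 (by omega)), ENNReal.ofReal_natCast,
    ENNReal.ofReal_ofNat, Nat.cast_ofNat]

end HalfFileScheme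

end MultigraphPIR

end

theorem mainTheorem3 (N : ℕ) (hN : 0 < N) (hEven : Even N) :
    (∀ r : ℕ, 1 ≤ r →
      MultigraphPIR.capacity (SimpleGraph.pathGraph N) r
        = ENNReal.ofReal (2 / (N : ℝ) * (1 / (2 - (2 : ℝ) ^ (1 - (r : ℤ)))))) ∧
    (∃ T : MultigraphPIR.PIRScheme (SimpleGraph.pathGraph N) 1 2,
      T.SymmetricRetrieval ∧ T.rate = ENNReal.ofReal (2 / (N : ℝ))) := by
  obtain ⟨m, rfl⟩ := even_iff_exists_two_mul.1 hEven
  -- The order `m * 2` matches the index type of `finProdFinEquiv` used for the matching.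
  rw [mul_comm 2 m] at *
  have hm : 0 < m := by omega
  refine ⟨fun r hr => ?_, MultigraphPIR.halfFileScheme _,
    MultigraphPIR.halfFileScheme_symmetricRetrieval,
    MultigraphPIR.halfFileScheme_rate (by omega)⟩
  have hc := MultigraphPIR.two_sub_two_mul_pow_pos hr
  have hm0 : (0 : ℝ) < m := Nat.cast_pos.2 hm
  have hpow : (2 : ℝ) ^ (1 - (r : ℤ)) = 2 * (1 / 2) ^ r := by
    rw [zpow_sub₀ two_ne_zero, zpow_one, zpow_natCast, one_div, inv_pow, div_eq_mul_inv]
  rw [hpow]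
  refine le_antisymm ?_ ((le_of_eq ?_).trans
    (MultigraphPIR.le_capacity_pathGraph (N := m * 2) (by omega) hr))
  · refine iSup_le fun L => iSup_le fun hL => iSup_le fun T => ?_
    refine (MultigraphPIR.rate_pathGraph_le hm hr hL T).trans
      (ENNReal.ofReal_le_ofReal (le_of_eq ?_))
    push_cast
    field_simp
  · have hc' : (0 : ℝ) < 1 - (1 / 2) ^ r := by linarith
    congr 1
    push_cast
    have : (2 : ℝ) - 2 * (1 / 2) ^ r = 2 * (1 - (1 / 2) ^ r) := by ring
    rw [this]
    field_simp
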